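/- Let $d\ge 1$. On $\mathbb{C}^d\otimes\mathbb{C}^d$ let $F_d=\sum_{i,j=1}^d|ij\rangle\langle ji|$ be the flip operator and $\Pi_{\mathcal A}=\frac12(I_{d^2}-F_d)$ the orthogonal projection onto the antisymmetric subspace. A \emph{state} is a positive semidefinite operator of trace one; a state $\sigma$ is \emph{PPT} if its partial transpose $\sigma^{\Gamma}$ (transposition of the second tensor factor) is positive semidefinite; a state $\rho_{\mathcal A}$ is \emph{antisymmetric} if $\Pi_{\mathcal A}\,\rho_{\mathcal A}\,\Pi_{\mathcal A}=\rho_{\mathcal A}$. For an antisymmetric state $\rho_{\mathcal A}$, the Sindici--Piani semidefinite program is $$p^{\rm PPT}(\rho_{\mathcal A}):=\max\left\{\operatorname{Tr}(\Pi_{\mathcal A}\sigma)\;:\;\sigma\text{ is a PPT state on }\mathbb{C}^d\otimes\mathbb{C}^d,\ \ \Pi_{\mathcal A}\sigma\Pi_{\mathcal A}=\operatorname{Tr}(\Pi_{\mathcal A}\sigma)\,\rho_{\mathcal A}\right\},$$ and for $d\geq 2$ we set $p_{\min}(d):=\min_{\rho_{\mathcal A}}p^{\rm PPT}(\rho_{\mathcal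 A})$, the minimum being over all antisymmetric states $\rho_{\mathcal A}$ on $\mathbb{C}^d\otimes\mathbb{C}^d$. For even $d$ let $\Omega_d=\begin{pmatrix}0&I_{d/2}\\-I_{d/2}&0\end{pmatrix}$, $|\omega_d\rangle=\frac1{\sqrt d}\sum_{j=1}^d|jj\rangle$, and $$|\omega_d^{\Omega}\rangle=(I_d\otimes\Omega_d)|\omega_d\rangle=\frac1{\sqrt d}\sum_{i=1}^{d/2}\bigl(|i+d/2,\,i\rangle-|i,\,i+d/2\rangle\bigr).$$ \textbf{Theorem.} For every even integer $d\ge 4$, the operator $|\omega_d^{\Omega}\rangle\langle\omega_d^{\Omega}|$ is an antisymmetric state, the maximum defining $p^{\rm PPT}(\rho_{\mathcal A})$ (for every antisymmetric state $\rho_{\mathcal A}$ on $\mathbb{C}^d\otimes\mathbb{C}^d$) and the minimum defining $p_{\min}(d)$ are attained, and $$p_{\min}(d)=p^{\rm PPT}\bigl(|\omega_d^{\Omega}\rangle\langle\omega_d^{\Omega}|\bigr)=\frac1{d+2}.$$ (With $d=2r$: the lower bound $p_{\min}(2r)\ge\frac1{2r+2}$ is an equality for every $r\ge 2$, as conjectured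 by Pál and Vértesi.) -/

import Mathlib

open scoped Kronecker ComplexOrder Matrix

noncomputable section

namespace SindiciPiani

/-- Operators on `ℂ^d ⊗ ℂ^d`, as matrices in the product basis `|ij⟩`. -/
abbrev BipartiteOp (d : ℕ) : Type := Matrix (Fin d × Fin d) (Fin d × Fin d) ℂ

/-- The flip operator `F_d = ∑ i j, |ij⟩⟨ji|`. -/
def flipOp (d : ℕ) : BipartiteOp d :=
  Matrix.of fun x y => if x.1 = y.2 ∧ x.2 = y.1 then 1 else 0

/-- The orthogonal projection `(I - F_d) / 2` onto the antisymmetric subspace. -/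
def projAntisymm (d : ℕ) : BipartiteOp d := (1 / 2 : ℂ) • (1 - flipOp d)

/-- A (mixed) quantum state: a positive semidefinite matrix of trace one. -/
def IsState {d : ℕ} (ρ : BipartiteOp d) : Prop := ρ.PosSemidef ∧ ρ.trace = 1

/-- Partial transpose on the second tensor factor:
`⟨i k| ρ^Γ |j l⟩ = ⟨i l| ρ |j k⟩`. -/
def partialTranspose {d : ℕ} (ρ : BipartiteOp d) : BipartiteOp d :=
  Matrix.of fun x y => ρ (x.1, y.2) (y.1, x.2)

/-- A state whose partial transpose is positive semidefinite. -/
def IsPPTState {d : ℕ} (σ : BipartiteOp d) : Prop :=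
  IsState σ ∧ (partialTranspose σ).PosSemidef

/-- A state `ρ` with `Π_A ρ Π_A = ρ`. -/
def IsAntisymmState {d : ℕ} (ρ : BipartiteOp d) : Prop :=
  IsState ρ ∧ projAntisymm d * ρ * projAntisymm d = ρ

/-- The values of the objective `Tr(Π_A σ)` on the feasible set of the Sindici–Piani
semidefinite program of `ρ`: `σ` is a PPT state with `Π_A σ Π_A = Tr(Π_A σ) ρ`. -/
def sdpValues {d : ℕ} (ρ : BipartiteOp d) : Set ℝ :=
  {p | ∃ σ : BipartiteOp d, IsPPTState σ ∧
    projAntisymm d * σ * projAntisymm d = (projAntisymm d * σ).trace • ρ ∧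
    (p : ℂ) = (projAntisymm d * σ).trace}

/-- The optimal value `p^PPT(ρ)` of the Sindici–Piani semidefinite program. -/
def pPPT {d : ℕ} (ρ : BipartiteOp d) : ℝ := sSup (sdpValues ρ)

/-- The values of `p^PPT` on all antisymmetric states of `ℂ^d ⊗ ℂ^d`. -/
def pPPTValues (d : ℕ) : Set ℝ :=
  {p | ∃ ρ : BipartiteOp d, IsAntisymmState ρ ∧ p = pPPT ρ}

/-- The optimal lower bound `p_min(d)` of `p^PPT` over antisymmetric states. -/
def pMin (d : ℕ) : ℝ := sInf (pPPTValues d)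

/-- The symplectic form `Ω_d = (0, I; -I, 0)` in blocks of size `d / 2` (for even `d`). -/
def omegaMatrix (d : ℕ) : Matrix (Fin d) (Fin d) ℂ :=
  Matrix.of fun i j =>
    if (j : ℕ) = i + d / 2 then 1 else if (i : ℕ) = j + d / 2 then -1 else 0

/-- The maximally entangled vector `|ω_d⟩ = d^(-1/2) ∑ j, |jj⟩`. -/
def maxEntangled (d : ℕ) : Fin d × Fin d → ℂ :=
  fun x => if x.1 = x.2 then ((1 / Real.sqrt d : ℝ) : ℂ) else 0

/-- The vector `|ω_d^Ω⟩ = (I_d ⊗ Ω_d) |ω_d⟩`. -/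
def twistedEntangled (d : ℕ) : Fin d × Fin d → ℂ :=
  ((1 : Matrix (Fin d) (Fin d) ℂ) ⊗ₖ omegaMatrix d) *ᵥ maxEntangled d

/-- The rank-one operator `|ω_d^Ω⟩⟨ω_d^Ω|`. -/
def twistedState (d : ℕ) : BipartiteOp d :=
  Matrix.vecMulVec (twistedEntangled d) (star (twistedEntangled d))

end SindiciPiani

end

/-! Lower bound: an antisymmetric vector `v` is an antisymmetric matrix `A`. With `P = √(A Aᴴ)`, the
symmetric operator `S = (1 + F)(P ⊗ P)` repairs the partial transpose of `v vᴴ`, and Cauchy–Schwarz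
gives `tr S = (tr P)² + tr P² ≤ (d + 1) ‖v‖²` (`exists_symm_completion_vecMulVec`). Summing over
vectors handles every antisymmetric state `ρ`; normalizing `ρ + S` gives a feasible point of value
at least `1/(d+2)` (`exists_mem_sdpValues`).

Upper bound for the twisted state `ω`: the witness `W = (1 - d ω)/2 - F/d` has positive semidefinite
partial transpose (`posSemidef_witness`), so `tr (W σ) ≥ 0` for PPT `σ`. For feasible `σ` of value
`p` this reads `(d - 2)(1 - (d + 2) p) ≥ 0`. Compactness of the feasible set gives attainment. -/

open scoped Kronecker ComplexOrder Matrix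

namespace SindiciPiani

/-! ### Positive semidefinite matrices -/

section PosSemidef

variable {m n : Type*} [Fintype m] [Fintype n]

open scoped MatrixOrder in
lemma exists_eq_conjTranspose_mul_self {M : Matrix n n ℂ} (hM : M.PosSemidef) :
    ∃ B : Matrix n n ℂ, M = Bᴴ * B := by
  classical
  exact CStarAlgebra.nonneg_iff_eq_star_mul_self.mp hM.nonneg

/-- This is the congruence `Vᴴ M V`, where column `i` of `V` is `e_{f i} + e_{g i}`. -/
lemma posSemidef_sum_submatrix {M : Matrix n n ℂ} (hM : M.PosSemidef) (f g : m → n) :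
    (M.submatrix f f + M.submatrix f g + M.submatrix g f + M.submatrix g g).PosSemidef := by
  obtain ⟨B, rfl⟩ := exists_eq_conjTranspose_mul_self hM
  convert Matrix.posSemidef_conjTranspose_mul_self (B.submatrix id f + B.submatrix id g) using 1
  ext i j
  simp only [Matrix.add_apply, Matrix.submatrix_apply, Matrix.mul_apply,
    Matrix.conjTranspose_apply, id, star_add, ← Finset.sum_add_distrib]
  exact Finset.sum_congr rfl fun k _ => by ring

lemma posSemidef_of_two_smul {ι : Type*} {M : Matrix ι ι ℂ} (h : ((2 : ℝ) • M).PosSemidef) :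
    M.PosSemidef := by
  have := h.smul (show (0 : ℝ) ≤ 1 / 2 by norm_num)
  rwa [smul_smul, show (1 / 2 : ℝ) * 2 = 1 by norm_num, one_smul] at this

lemma trace_mul_nonneg {M N : Matrix n n ℂ} (hM : M.PosSemidef) (hN : N.PosSemidef) :
    0 ≤ (M * N).trace := by
  obtain ⟨B, rfl⟩ := exists_eq_conjTranspose_mul_self hM
  rw [mul_assoc, Matrix.trace_mul_comm]
  exact (hN.mul_mul_conjTranspose_same B).trace_nonneg

lemma norm_apply_le_trace {M : Matrix n n ℂ} (hM : M.PosSemidef) (i j : n) :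
    ‖M i j‖ ≤ M.trace.re := by
  obtain ⟨B, rfl⟩ := exists_eq_conjTranspose_mul_self hM
  have hdiag (a : n) : ((Bᴴ * B) a a).re = ∑ k, ‖B k a‖ ^ 2 := by
    simp only [Matrix.mul_apply, Matrix.conjTranspose_apply, Complex.re_sum]
    refine Finset.sum_congr rfl fun k _ => ?_
    rw [Complex.star_def, ← Complex.normSq_eq_conj_mul_self, Complex.ofReal_re,
      Complex.normSq_eq_norm_sq]
  have htr (a : n) : ∑ k, ‖B k a‖ ^ 2 ≤ (Bᴴ * B).trace.re := by
    rw [Matrix.trace, Complex.re_sum, ← hdiag]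
    simp only [Matrix.diag_apply]
    refine Finset.single_le_sum (f := fun a => ((Bᴴ * B) a a).re) (fun b _ => ?_)
      (Finset.mem_univ a)
    rw [hdiag]; positivity
  calc ‖(Bᴴ * B) i j‖ ≤ ∑ k, ‖B k i‖ * ‖B k j‖ := by
        rw [Matrix.mul_apply]
        refine (norm_sum_le _ _).trans_eq (Finset.sum_congr rfl fun k _ => ?_)
        simp
    _ ≤ ∑ k, (‖B k i‖ ^ 2 + ‖B k j‖ ^ 2) / 2 :=
        Finset.sum_le_sum fun k _ => by nlinarith [sq_nonneg (‖B k i‖ - ‖B k j‖)]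
    _ ≤ _ := by
        rw [← Finset.sum_div, Finset.sum_add_distrib]
        linarith [htr i, htr j]

lemma isClosed_posSemidef : IsClosed {M : Matrix n n ℂ | M.PosSemidef} := by
  simp only [Matrix.posSemidef_iff_dotProduct_mulVec, Set.ofPred_and, Set.ofPred_forall]
  refine IsClosed.inter ?_ (isClosed_iInter fun x => ?_)
  · exact isClosed_eq (by fun_prop) continuous_id
  · exact isClosed_Ici.preimage (f := fun M : Matrix n n ℂ => star x ⬝ᵥ M *ᵥ x) (by fun_prop)

/-- Cauchy–Schwarz on the diagonal, after which the off-diagonal squares only help. This is the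
source of the factor `d` in the trace bound. -/
lemma re_trace_sq_le {P : Matrix n n ℂ} (hP : P.IsHermitian) :
    P.trace.re ^ 2 ≤ Fintype.card n * (P * P).trace.re := by
  have h1 : P.trace.re ^ 2 ≤ Fintype.card n * ∑ i, (P i i).re ^ 2 := by
    rw [Matrix.trace, Complex.re_sum]
    exact sq_sum_le_card_mul_sum_sq
  refine h1.trans (mul_le_mul_of_nonneg_left ?_ (by positivity))
  rw [Matrix.trace, Complex.re_sum]
  refine Finset.sum_le_sum fun i _ => ?_
  have h2 (j : n) : (P i j * P j i).re = ‖P i j‖ ^ 2 := by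
    rw [← hP.apply j i, Complex.star_def, Complex.mul_conj, Complex.ofReal_re,
      Complex.normSq_eq_norm_sq]
  simp only [Matrix.diag_apply, Matrix.mul_apply, Complex.re_sum, h2]
  refine le_trans ?_ (Finset.single_le_sum (f := fun j => ‖P i j‖ ^ 2)
    (fun j _ => by positivity) (Finset.mem_univ i))
  exact sq_le_sq' (neg_le_of_abs_le (Complex.abs_re_le_norm _)) (Complex.re_le_norm _)

variable [DecidableEq n]

open scoped MatrixOrder Matrix.Norms.L2Operator in
/-- The blocks of `|H|` for `H = (0, A; Aᴴ, 0)` with `A` antisymmetric. -/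
lemma exists_posSemidef_fromBlocks (A : Matrix n n ℂ) (hA : Aᵀ = -A) :
    ∃ P : Matrix n n ℂ, P.PosSemidef ∧ P * P = A * Aᴴ ∧
      (Matrix.fromBlocks P A Aᴴ Pᵀ).PosSemidef := by
  have hAA : (0 : Matrix n n ℂ) ≤ A * Aᴴ := (Matrix.posSemidef_self_mul_conjTranspose A).nonneg
  have hP : (CFC.sqrt (A * Aᴴ)).PosSemidef :=
    Matrix.nonneg_iff_posSemidef.mp (CFC.sqrt_nonneg _)
  have hPP : CFC.sqrt (A * Aᴴ) * CFC.sqrt (A * Aᴴ) = A * Aᴴ := CFC.sqrt_mul_sqrt_self _ hAA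
  generalize CFC.sqrt (A * Aᴴ) = P at hP hPP
  refine ⟨P, hP, hPP, ?_⟩
  set H : Matrix (n ⊕ n) (n ⊕ n) ℂ := Matrix.fromBlocks 0 A Aᴴ 0
  set D : Matrix (n ⊕ n) (n ⊕ n) ℂ := Matrix.fromBlocks P 0 0 Pᵀ
  have hH : IsSelfAdjoint H := by
    show Hᴴ = H
    simp [H, Matrix.fromBlocks_conjTranspose]
  have hD : D.PosSemidef := by
    obtain ⟨B, rfl⟩ := exists_eq_conjTranspose_mul_self hP
    convert Matrix.posSemidef_conjTranspose_mul_self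
      (Matrix.fromBlocks B 0 0 (Bᴴᵀ)) using 1
    simp [D, Matrix.fromBlocks_conjTranspose, Matrix.fromBlocks_multiply]
    congr 1
    ext i j
    simp
  -- Antisymmetry of `A` is what makes the second diagonal block of `|H|` equal to `Pᵀ`.
  have hAA' : Pᵀ * Pᵀ = Aᴴ * A := by
    have h : Aᴴᵀ = -Aᴴ := by
      rw [← Matrix.conjTranspose_neg, ← hA]; rfl
    rw [← Matrix.transpose_mul, hPP, Matrix.transpose_mul, h, hA, neg_mul_neg]
  have habs : CFC.abs H = D := by
    refine CFC.sqrt_unique ?_ hD.nonneg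
    rw [hH.star_eq]
    simp [D, H, Matrix.fromBlocks_multiply, hPP, hAA']
  -- `|H| + H` is twice the positive part of `H`.
  have h : Matrix.fromBlocks P A Aᴴ Pᵀ = CFC.abs H + H := by
    rw [habs]; simp [D, H, Matrix.fromBlocks_add]
  rw [h, CFC.abs_add_self H hH]
  exact Matrix.nonneg_iff_posSemidef.mp (smul_nonneg (by norm_num) (CFC.posPart_nonneg H))

end PosSemidef

/-! ### The flip and the partial transpose -/

variable {d : ℕ}

lemma flipOp_mul (M : BipartiteOp d) : flipOp d * M = M.submatrix Prod.swap id := by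
  ext x y
  rw [Matrix.mul_apply, Finset.sum_eq_single x.swap]
  · simp [flipOp]
  · rintro z - hz
    rw [flipOp, Matrix.of_apply, if_neg, zero_mul]
    rintro ⟨h1, h2⟩
    exact hz (Prod.ext h2.symm h1.symm)
  · simp

lemma flipOp_transpose : (flipOp d)ᵀ = flipOp d := by
  ext x y
  simp only [flipOp, Matrix.transpose_apply, Matrix.of_apply]
  congr 1
  exact propext ⟨fun h => ⟨h.2.symm, h.1.symm⟩, fun h => ⟨h.2.symm, h.1.symm⟩⟩

lemma flipOp_conjTranspose : (flipOp d)ᴴ = flipOp d := by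
  refine Eq.trans ?_ flipOp_transpose
  ext x y
  simp [flipOp, apply_ite]

lemma flipOp_mul_flipOp : flipOp d * flipOp d = 1 := by
  rw [flipOp_mul]
  ext x y
  simp [flipOp, Matrix.one_apply, Prod.ext_iff, and_comm]

lemma projAntisymm_conjTranspose : (projAntisymm d)ᴴ = projAntisymm d := by
  simp [projAntisymm, flipOp_conjTranspose]

lemma projAntisymm_mul_self : projAntisymm d * projAntisymm d = projAntisymm d := by
  simp only [projAntisymm, smul_mul_smul_comm, sub_mul, mul_sub, one_mul, mul_one,
    flipOp_mul_flipOp]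
  module

lemma projAntisymm_mul_eq_zero {M : BipartiteOp d} (hM : M.submatrix Prod.swap id = M) :
    projAntisymm d * M = 0 := by
  simp [projAntisymm, sub_mul, flipOp_mul, hM]

lemma projAntisymm_mul_eq_self {M : BipartiteOp d} (hM : M.submatrix Prod.swap id = -M) :
    projAntisymm d * M = M := by
  rw [projAntisymm, smul_mul_assoc, sub_mul, flipOp_mul, hM, one_mul]
  module

lemma submatrix_swap_of_projAntisymm_mul {M : BipartiteOp d} (hM : projAntisymm d * M = M) :
    M.submatrix Prod.swap id = -M := by
  have h : flipOp d * M = M - (2 : ℂ) • (projAntisymm d * M) := by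
    rw [projAntisymm, smul_mul_assoc, sub_mul, one_mul]
    module
  rw [← flipOp_mul, h, hM]
  module

lemma projAntisymm_mul_mul_self {M : BipartiteOp d} (hM : M.IsHermitian)
    (h : projAntisymm d * M = M) : projAntisymm d * M * projAntisymm d = M := by
  rw [h]
  simpa [hM.eq, projAntisymm_conjTranspose] using congrArg Matrix.conjTranspose h

lemma IsAntisymmState.projAntisymm_mul {ρ : BipartiteOp d} (hρ : IsAntisymmState ρ) :
    projAntisymm d * ρ = ρ := by
  conv_lhs => rw [← hρ.2]
  rw [← mul_assoc, ← mul_assoc, projAntisymm_mul_self, hρ.2]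

lemma partialTranspose_sub (M N : BipartiteOp d) :
    partialTranspose (M - N) = partialTranspose M - partialTranspose N := rfl

lemma partialTranspose_smul {R : Type*} [SMul R ℂ] (c : R) (M : BipartiteOp d) :
    partialTranspose (c • M) = c • partialTranspose M := rfl

lemma partialTranspose_sum {ι : Type*} (s : Finset ι) (M : ι → BipartiteOp d) :
    partialTranspose (∑ k ∈ s, M k) = ∑ k ∈ s, partialTranspose (M k) := by
  ext x y
  simp [partialTranspose, Matrix.sum_apply]

lemma partialTranspose_one : partialTranspose (1 : BipartiteOp d) = 1 := by
  ext x y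
  simp [partialTranspose, Matrix.one_apply, Prod.ext_iff, eq_comm]

lemma continuous_partialTranspose :
    Continuous (partialTranspose : BipartiteOp d → BipartiteOp d) :=
  continuous_matrix fun _ _ => continuous_id.matrix_elem _ _

lemma trace_partialTranspose_mul (M N : BipartiteOp d) :
    (partialTranspose M * partialTranspose N).trace = (M * N).trace := by
  simp only [Matrix.trace, Matrix.diag_apply, Matrix.mul_apply, partialTranspose,
    Matrix.of_apply, Fintype.sum_prod_type]
  refine Finset.sum_congr rfl fun i _ => ?_
  rw [Finset.sum_comm]
  conv_rhs => rw [Finset.sum_comm]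
  refine Finset.sum_congr rfl fun j _ => ?_
  rw [Finset.sum_comm]

/-! ### The maximum is attained -/

/-- The feasible set of the Sindici–Piani semidefinite program. -/
def feasibleSet (ρ : BipartiteOp d) : Set (BipartiteOp d) :=
  {σ | IsPPTState σ ∧
    projAntisymm d * σ * projAntisymm d = (projAntisymm d * σ).trace • ρ}

lemma isCompact_feasibleSet (ρ : BipartiteOp d) : IsCompact (feasibleSet ρ) := by
  have hK : IsCompact (Set.univ.pi fun _ => Set.univ.pi fun _ => Metric.closedBall 0 1 :
      Set (BipartiteOp d)) :=
    isCompact_univ_pi fun _ => isCompact_univ_pi fun _ => isCompact_closedBall _ _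
  refine hK.of_isClosed_subset ?_ ?_
  · refine IsClosed.inter (IsClosed.inter (IsClosed.inter isClosed_posSemidef ?_) ?_) ?_
    · exact isClosed_eq (by fun_prop) continuous_const
    · exact isClosed_posSemidef.preimage continuous_partialTranspose
    · exact isClosed_eq (by fun_prop) (by fun_prop)
  -- Entries of a positive semidefinite matrix are bounded by its trace, here 1.
  · rintro σ ⟨⟨⟨h1, h2⟩, -⟩, -⟩ x - y -
    have := norm_apply_le_trace h1 x y
    rw [h2] at this
    simpa using this

lemma sdpValues_eq_image {ρ : BipartiteOp d} :
    sdpValues ρ = (fun σ => (projAntisymm d * σ).trace.re) '' feasibleSet ρ := by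
  ext p
  constructor
  · rintro ⟨σ, h1, h2, h3⟩
    exact ⟨σ, ⟨h1, h2⟩, by simp [← h3]⟩
  · rintro ⟨σ, ⟨h1, h2⟩, rfl⟩
    refine ⟨σ, h1, h2, ?_⟩
    have h : 0 ≤ (projAntisymm d * σ).trace := by
      refine trace_mul_nonneg ?_ h1.1.1
      rw [← projAntisymm_mul_self]
      nth_rw 1 [← projAntisymm_conjTranspose]
      exact Matrix.posSemidef_conjTranspose_mul_self _
    exact (Complex.eq_re_of_ofReal_le (r := 0) (by simpa using h)).symm

lemma isGreatest_pPPT {ρ : BipartiteOp d} (h : (sdpValues ρ).Nonempty) :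
    IsGreatest (sdpValues ρ) (pPPT ρ) := by
  have hc : IsCompact (sdpValues ρ) := by
    rw [sdpValues_eq_image]
    exact (isCompact_feasibleSet ρ).image (by fun_prop)
  exact ⟨hc.sSup_mem h, fun p hp => le_csSup hc.bddAbove hp⟩

/-! ### The lower bound -/

/-- A symmetric completion of the rank-one operator of an antisymmetric vector, with positive
semidefinite partial transpose and controlled trace. -/
lemma exists_symm_completion_vecMulVec (v : Fin d × Fin d → ℂ) (hv : ∀ x, v x.swap = -v x) :
    ∃ S : BipartiteOp d, S.PosSemidef ∧ projAntisymm d * S = 0 ∧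
      (partialTranspose (Matrix.vecMulVec v (star v) + S)).PosSemidef ∧
      S.trace.re ≤ (d + 1) * (Matrix.vecMulVec v (star v)).trace.re := by
  set A : Matrix (Fin d) (Fin d) ℂ := Matrix.of fun i j => v (i, j)
  obtain ⟨P, hP, hPP, hM⟩ := exists_posSemidef_fromBlocks A (by ext i j; exact hv (i, j))
  set M := Matrix.fromBlocks P A Aᴴ Pᵀ
  -- `S = (1 + F)(P ⊗ P)`. Its partial transpose is `P ⊗ Pᵀ` plus the rank-one operator of the
  -- vector with entries `P i j`.
  set S : BipartiteOp d := Matrix.of fun x y => P x.1 y.1 * P x.2 y.2 + P x.2 y.1 * P x.1 y.2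
  refine ⟨S, ?_, ?_, ?_, ?_⟩
  · refine posSemidef_of_two_smul ?_
    convert posSemidef_sum_submatrix (hP.kronecker hP) id Prod.swap using 1
    ext x y
    simp [S, Matrix.kroneckerMap_apply]
    ring
  · refine projAntisymm_mul_eq_zero ?_
    ext x y
    simp only [S, Matrix.submatrix_apply, Matrix.of_apply, Prod.fst_swap, Prod.snd_swap, id]
    ring
  -- In `M ⊗ M`, the two diagonal terms of the compression each give `P ⊗ Pᵀ`, and the two cross
  -- terms, products of an `A` and an `Aᴴ` entry, each give the partial transpose of `v vᴴ`.
  · have h1 := posSemidef_of_two_smul (M := partialTranspose (Matrix.vecMulVec v (star v)) +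
        P ⊗ₖ Pᵀ) (by
      convert posSemidef_sum_submatrix (hM.kronecker hM)
        (fun x : Fin d × Fin d => (Sum.inl x.1, Sum.inr x.2))
        (fun x : Fin d × Fin d => (Sum.inr x.2, Sum.inl x.1)) using 1
      ext x y
      simp [M, A, partialTranspose, Matrix.vecMulVec_apply, Matrix.kroneckerMap_apply]
      ring)
    convert h1.add (Matrix.posSemidef_vecMulVec_self_star (fun x : Fin d × Fin d => P x.1 x.2))
      using 1
    ext x y
    simp only [S, partialTranspose, Matrix.vecMulVec_apply, Matrix.kroneckerMap_apply,
      Matrix.add_apply, Matrix.of_apply, Matrix.transpose_apply, Pi.star_apply,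
      hP.1.apply]
    ring
  · have hS : S.trace = P.trace ^ 2 + (P * P).trace := by
      simp only [S, Matrix.trace, Matrix.diag_apply, Matrix.of_apply, Finset.sum_add_distrib,
        Matrix.mul_apply, Fintype.sum_prod_type, sq, Finset.sum_mul_sum]
      congr 1
      exact Finset.sum_congr rfl fun i _ => Finset.sum_congr rfl fun j _ => mul_comm _ _
    have hA : (Matrix.vecMulVec v (star v)).trace = (P * P).trace := by
      simp [hPP, A, Matrix.trace, Matrix.mul_apply, Matrix.vecMulVec_apply,
        Fintype.sum_prod_type]
    have him : P.trace.im = 0 := ((Complex.le_def.mp hP.trace_nonneg).2).symm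
    have hcs := re_trace_sq_le hP.1
    rw [Fintype.card_fin] at hcs
    rw [hS, hA, Complex.add_re, sq, Complex.mul_re, him]
    linarith

/-- The completion of `exists_symm_completion_vecMulVec` for every operator supported on the
antisymmetric subspace. -/
lemma exists_symm_completion {ρ : BipartiteOp d} (hρ : ρ.PosSemidef)
    (hanti : projAntisymm d * ρ * projAntisymm d = ρ) :
    ∃ S : BipartiteOp d, S.PosSemidef ∧ projAntisymm d * S = 0 ∧
      (partialTranspose (ρ + S)).PosSemidef ∧ S.trace.re ≤ (d + 1) * ρ.trace.re := by
  obtain ⟨B, hB⟩ := exists_eq_conjTranspose_mul_self hρ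
  set C := projAntisymm d * Bᴴ
  have hC : C.submatrix Prod.swap id = -C :=
    submatrix_swap_of_projAntisymm_mul (by rw [← mul_assoc, projAntisymm_mul_self])
  have hρC : ρ = ∑ k, Matrix.vecMulVec (fun x => C x k) (star fun x => C x k) := by
    have h : ρ = C * Cᴴ := by
      rw [Matrix.conjTranspose_mul, projAntisymm_conjTranspose, Matrix.conjTranspose_conjTranspose]
      conv_lhs => rw [← hanti, hB]
      simp only [C, mul_assoc]
    ext x y
    simp [h, Matrix.mul_apply, Matrix.sum_apply, Matrix.vecMulVec_apply]
  choose S h1 h2 h3 h4 using fun k => exists_symm_completion_vecMulVec (fun x => C x k)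
    (fun x => congrFun (congrFun hC x) k)
  refine ⟨∑ k, S k, Matrix.posSemidef_sum _ fun k _ => h1 k, ?_, ?_, ?_⟩
  · simp [Finset.mul_sum, h2]
  · rw [hρC, ← Finset.sum_add_distrib, partialTranspose_sum]
    exact Matrix.posSemidef_sum _ fun k _ => h3 k
  · rw [hρC, Matrix.trace_sum, Matrix.trace_sum, Complex.re_sum, Complex.re_sum, Finset.mul_sum]
    exact Finset.sum_le_sum fun k _ => h4 k

/-- The completion `S` is invisible to `Π_A`, so `(ρ + S) / t` with `t = 1 + tr S ≤ d + 2` has value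
`1 / t`. -/
lemma exists_mem_sdpValues {ρ : BipartiteOp d} (hρ : IsAntisymmState ρ) :
    ∃ p ∈ sdpValues ρ, 1 / ((d : ℝ) + 2) ≤ p := by
  obtain ⟨S, hS, hSA, hpt, htr⟩ := exists_symm_completion hρ.1.1 hρ.2
  set t : ℝ := 1 + S.trace.re
  have hS0 := Complex.le_def.mp hS.trace_nonneg
  have ht : 0 < t := by have := hS0.1; simp only [Complex.zero_re] at this; positivity
  have hStr : S.trace = (S.trace.re : ℂ) := Complex.ext (by simp) (by simpa using hS0.2.symm)
  have hpos : (0 : ℝ) ≤ 1 / t := by positivity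
  have hval : (projAntisymm d * ((1 / t) • (ρ + S))).trace = ((1 / t : ℝ) : ℂ) := by
    rw [mul_smul_comm, mul_add, hSA, hρ.projAntisymm_mul, add_zero, Matrix.trace_smul, hρ.1.2]
    simp
  refine ⟨1 / t, ⟨(1 / t) • (ρ + S), ⟨⟨(hρ.1.1.add hS).smul hpos, ?_⟩, hpt.smul hpos⟩, ?_,
    hval.symm⟩, ?_⟩
  · rw [Matrix.trace_smul, Matrix.trace_add, hρ.1.2, hStr, ← Complex.ofReal_one,
      ← Complex.ofReal_add, Complex.real_smul, ← Complex.ofReal_mul]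
    congr 1
    field_simp
    rfl
  · rw [hval, mul_smul_comm, mul_add, hSA, smul_mul_assoc, add_zero, hρ.2, Complex.coe_smul]
  · rw [hρ.1.2, Complex.one_re] at htr
    exact one_div_le_one_div_of_le ht (by simp only [t]; linarith)

/-! ### The twisted maximally entangled state -/

lemma omegaMatrix_antisymm (hd : 0 < d) (heven : Even d) (i j : Fin d) :
    omegaMatrix d i j = -omegaMatrix d j i := by
  obtain ⟨r, rfl⟩ := heven
  simp only [omegaMatrix, Matrix.of_apply]
  split_ifs <;> first | omega | simp

lemma star_omegaMatrix (i j : Fin d) : star (omegaMatrix d i j) = omegaMatrix d i j := by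
  simp only [omegaMatrix, Matrix.of_apply]
  split_ifs <;> simp

lemma sum_omegaMatrix_mul (heven : Even d) (i k : Fin d) :
    ∑ j, omegaMatrix d i j * omegaMatrix d k j = if i = k then 1 else 0 := by
  obtain ⟨r, rfl⟩ := heven
  have hi := i.2
  have hk := k.2
  -- `τ` is the only column where row `i` of `Ω` is nonzero.
  obtain ⟨τ, hτ⟩ : ∃ τ : Fin (r + r), (τ : ℕ) = i + r ∨ (i : ℕ) = τ + r := by
    by_cases h : (i : ℕ) < r
    · exact ⟨⟨i + r, by omega⟩, Or.inl rfl⟩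
    · exact ⟨⟨i - r, by omega⟩, Or.inr (by simp only; omega)⟩
  have hr : (r + r) / 2 = r := by omega
  rw [Finset.sum_eq_single τ]
  · simp only [omegaMatrix, Matrix.of_apply, hr, Fin.ext_iff]
    split_ifs <;> first | omega | simp
  · rintro j - hj
    have hj' : (j : ℕ) ≠ τ := fun h => hj (Fin.ext h)
    simp only [omegaMatrix, Matrix.of_apply, hr]
    rw [if_neg (by omega), if_neg (by omega), zero_mul]
  · simp

lemma sum_omegaMatrix_mul' (hd : 0 < d) (heven : Even d) (i k : Fin d) :
    ∑ j, omegaMatrix d j i * omegaMatrix d j k = if i = k then 1 else 0 := by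
  rw [← sum_omegaMatrix_mul heven]
  refine Finset.sum_congr rfl fun j _ => ?_
  rw [omegaMatrix_antisymm hd heven j i, omegaMatrix_antisymm hd heven j k, neg_mul_neg]

lemma twistedEntangled_apply (x : Fin d × Fin d) :
    twistedEntangled d x = omegaMatrix d x.2 x.1 * ((1 / Real.sqrt d : ℝ) : ℂ) := by
  simp [twistedEntangled, Matrix.mulVec, dotProduct, Fintype.sum_prod_type, maxEntangled,
    Matrix.kroneckerMap_apply, Matrix.one_apply]

lemma natCast_smul_twistedState (hd : 0 < d) :
    (d : ℂ) • twistedState d =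
      Matrix.of fun x y => omegaMatrix d x.2 x.1 * omegaMatrix d y.2 y.1 := by
  ext x y
  have h : (((1 / Real.sqrt d : ℝ) : ℂ)) * ((1 / Real.sqrt d : ℝ) : ℂ) = (d : ℂ)⁻¹ := by
    rw [← Complex.ofReal_mul, div_mul_div_comm, Real.mul_self_sqrt (by positivity)]
    simp
  have hd' : (d : ℂ) ≠ 0 := by exact_mod_cast hd.ne'
  simp only [twistedState, Matrix.smul_apply, Matrix.vecMulVec_apply, Pi.star_apply,
    twistedEntangled_apply, star_mul', star_omegaMatrix, Complex.star_def, Complex.conj_ofReal,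
    smul_eq_mul, Matrix.of_apply]
  calc _ = (d : ℂ) * (((1 / Real.sqrt d : ℝ) : ℂ) * ((1 / Real.sqrt d : ℝ) : ℂ)) *
        (omegaMatrix d x.2 x.1 * omegaMatrix d y.2 y.1) := by ring
    _ = _ := by rw [h, mul_inv_cancel₀ hd', one_mul]

lemma isAntisymmState_twistedState (hd : 0 < d) (heven : Even d) :
    IsAntisymmState (twistedState d) := by
  have hd' : (d : ℂ) ≠ 0 := by exact_mod_cast hd.ne'
  have hpos : (twistedState d).PosSemidef := Matrix.posSemidef_vecMulVec_self_star _
  refine ⟨⟨hpos, mul_left_cancel₀ hd' ?_⟩, projAntisymm_mul_mul_self hpos.1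
    (projAntisymm_mul_eq_self ?_)⟩
  · rw [← smul_eq_mul, ← Matrix.trace_smul, natCast_smul_twistedState hd]
    simp [Matrix.trace, Fintype.sum_prod_type, sum_omegaMatrix_mul' hd heven]
  · ext x y
    simp only [twistedState, Matrix.submatrix_apply, Matrix.vecMulVec_apply, Matrix.neg_apply,
      twistedEntangled_apply, Prod.fst_swap, Prod.snd_swap, id]
    rw [omegaMatrix_antisymm hd heven x.1]
    ring

lemma twistedState_mul_self (hd : 0 < d) (heven : Even d) :
    twistedState d * twistedState d = twistedState d := by
  have h := (isAntisymmState_twistedState hd heven).1.2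
  rw [twistedState, Matrix.trace_vecMulVec] at h
  rw [twistedState, Matrix.vecMulVec_mul_vecMulVec, dotProduct_comm, h, one_smul]

/-- The dual witness is an orthogonal projection: the partial transpose of `d • twistedState d` is a
self-adjoint involution that maps the maximally entangled vector to its negative. -/
lemma posSemidef_witness (hd : 0 < d) (heven : Even d) :
    (partialTranspose ((1 / 2 : ℂ) • (1 - (d : ℂ) • twistedState d) -
      (1 / d : ℂ) • flipOp d)).PosSemidef := by
  have hd' : (d : ℂ) ≠ 0 := by exact_mod_cast hd.ne'
  set R := partialTranspose ((d : ℂ) • twistedState d) with hR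
  set E := partialTranspose (flipOp d) with hE
  have hRa (x y) : R x y = omegaMatrix d y.2 x.1 * omegaMatrix d x.2 y.1 := by
    simp only [hR, natCast_smul_twistedState hd, partialTranspose, Matrix.of_apply]
  have hEa (x y) : E x y = if x.1 = x.2 ∧ y.1 = y.2 then 1 else 0 := by
    simp only [hE, partialTranspose, flipOp, Matrix.of_apply, eq_comm (a := y.2)]
  have hRR : R * R = 1 := by
    ext x y
    simp only [Matrix.mul_apply, hRa, Fintype.sum_prod_type, Matrix.one_apply, Prod.ext_iff]
    calc _ = (∑ j, omegaMatrix d x.2 j * omegaMatrix d y.2 j) *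
          ∑ l, omegaMatrix d l x.1 * omegaMatrix d l y.1 := by
          rw [Finset.sum_mul_sum]
          exact Finset.sum_congr rfl fun _ _ => Finset.sum_congr rfl fun _ _ => by ring
      _ = _ := by
          rw [sum_omegaMatrix_mul heven, sum_omegaMatrix_mul' hd heven]
          simp only [mul_ite, mul_one, mul_zero, ite_and]
  have hRE : R * E = -E := by
    ext x y
    simp only [Matrix.mul_apply, hRa, hEa, Fintype.sum_prod_type, Matrix.neg_apply, ite_and]
    by_cases hy : y.1 = y.2
    · simp only [hy, if_true, mul_ite, mul_one, mul_zero, Finset.sum_ite_eq, Finset.mem_univ]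
      calc _ = -∑ j, omegaMatrix d x.1 j * omegaMatrix d x.2 j := by
            rw [← Finset.sum_neg_distrib]
            exact Finset.sum_congr rfl fun j _ => by
              rw [omegaMatrix_antisymm hd heven j x.1]; ring
        _ = _ := by rw [sum_omegaMatrix_mul heven]
    · simp [hy]
  have hRH : Rᴴ = R := by
    ext x y
    rw [Matrix.conjTranspose_apply, hRa, hRa, star_mul', star_omegaMatrix, star_omegaMatrix,
      mul_comm]
  have hEH : Eᴴ = E := by
    ext x y
    rw [Matrix.conjTranspose_apply, hEa, hEa]
    simp [apply_ite, and_comm]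
  have hER : E * R = -E := by
    simpa [hRH, hEH] using congrArg Matrix.conjTranspose hRE
  have hEE : E * E = (d : ℂ) • E := by
    ext x y
    simp only [Matrix.mul_apply, hEa, Fintype.sum_prod_type, Matrix.smul_apply, ite_and]
    by_cases hx : x.1 = x.2 <;> by_cases hy : y.1 = y.2 <;> simp [hx, hy]
  rw [partialTranspose_sub, partialTranspose_smul (1 / 2 : ℂ), partialTranspose_sub,
    partialTranspose_smul (1 / d : ℂ), partialTranspose_one, ← hR, ← hE]
  set N := (1 / 2 : ℂ) • (1 - R) - (1 / d : ℂ) • E with hN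
  have hNH : Nᴴ = N := by simp [hN, hRH, hEH]
  -- `E / d` projects onto the maximally entangled line, which lies in the range of the projection
  -- `(1 - R) / 2`; `N` is their difference.
  have hNN : N * N = N := by
    simp only [hN, sub_mul, mul_sub, smul_mul_assoc, mul_smul_comm, one_mul, mul_one, hRR, hRE,
      hER, hEE, smul_smul, one_div_mul_cancel hd']
    module
  rw [← hNN]
  nth_rw 1 [← hNH]
  exact Matrix.posSemidef_conjTranspose_mul_self _

/-- Weak duality: `σ` is paired with the witness after partially transposing both, which leaves the
trace unchanged. -/
lemma sdpValues_twistedState_le (hd : 4 ≤ d) (heven : Even d) {p : ℝ}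
    (hp : p ∈ sdpValues (twistedState d)) : p ≤ 1 / ((d : ℝ) + 2) := by
  have hd0 : 0 < d := by omega
  have hdR : (4 : ℝ) ≤ d := by exact_mod_cast hd
  obtain ⟨σ, ⟨⟨-, htr⟩, hpt⟩, hσ, hpσ⟩ := hp
  have hanti := isAntisymmState_twistedState hd0 heven
  -- The antisymmetric block of `σ` is `p` times the twisted state, which is pure.
  have hρσ : (twistedState d * σ).trace = p := by
    conv_lhs => rw [← hanti.2]
    rw [mul_assoc, mul_assoc, Matrix.trace_mul_comm, mul_assoc, hσ, mul_smul_comm,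
      Matrix.trace_smul, twistedState_mul_self hd0 heven, hanti.1.2, ← hpσ]
    simp
  have hF : (flipOp d * σ).trace = 1 - 2 * p := by
    have h : flipOp d = 1 - (2 : ℂ) • projAntisymm d := by
      rw [projAntisymm]; module
    rw [h, sub_mul, one_mul, smul_mul_assoc, Matrix.trace_sub, Matrix.trace_smul, htr, ← hpσ,
      smul_eq_mul]
  have h := trace_mul_nonneg (posSemidef_witness hd0 heven) hpt
  rw [trace_partialTranspose_mul] at h
  simp only [sub_mul, smul_mul_assoc, one_mul, Matrix.trace_sub, Matrix.trace_smul, hρσ, hF, htr,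
    smul_eq_mul] at h
  have h' : (0 : ℝ) ≤ 1 / 2 * (1 - d * p) - 1 / d * (1 - 2 * p) :=
    Complex.zero_le_real.mp (by push_cast; exact h)
  have h2 : (d : ℝ) * (1 / 2 * (1 - d * p) - 1 / d * (1 - 2 * p)) =
      (d - 2) * (1 - (d + 2) * p) / 2 := by
    field_simp
    ring
  have h3 : 0 ≤ ((d : ℝ) - 2) * (1 - (d + 2) * p) := by
    have := mul_nonneg (show (0 : ℝ) ≤ d by linarith) h'
    rw [h2] at this
    linarith
  -- Cancelling `d - 2` needs `d > 2`; at `d = 2` the inequality is vacuous.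
  have h4 := nonneg_of_mul_nonneg_right h3 (by linarith)
  rw [le_div_iff₀ (by linarith)]
  linarith

end SindiciPiani

theorem mainTheorem9 (d : ℕ) (hd : 4 ≤ d) (heven : Even d) :
    -- the maximum and the minimum in the definitions of `p^PPT` and `p_min` are attained
    (∀ ρ : SindiciPiani.BipartiteOp d, SindiciPiani.IsAntisymmState ρ →
      IsGreatest (SindiciPiani.sdpValues ρ) (SindiciPiani.pPPT ρ)) ∧
    IsLeast (SindiciPiani.pPPTValues d) (SindiciPiani.pMin d) ∧
    -- `|ω_d^Ω⟩⟨ω_d^Ω|` is an antisymmetric state, it is a minimizer, and the minimum is `1/(d+2)`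
    SindiciPiani.IsAntisymmState (SindiciPiani.twistedState d) ∧
    SindiciPiani.pMin d = SindiciPiani.pPPT (SindiciPiani.twistedState d) ∧
    SindiciPiani.pPPT (SindiciPiani.twistedState d) = 1 / ((d : ℝ) + 2) := by
  have hmax (ρ : SindiciPiani.BipartiteOp d) (hρ : SindiciPiani.IsAntisymmState ρ) :
      IsGreatest (SindiciPiani.sdpValues ρ) (SindiciPiani.pPPT ρ) :=
    let ⟨p, hp, _⟩ := SindiciPiani.exists_mem_sdpValues hρ
    SindiciPiani.isGreatest_pPPT ⟨p, hp⟩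
  have hlow (ρ : SindiciPiani.BipartiteOp d) (hρ : SindiciPiani.IsAntisymmState ρ) :
      1 / ((d : ℝ) + 2) ≤ SindiciPiani.pPPT ρ :=
    let ⟨_, hp, hle⟩ := SindiciPiani.exists_mem_sdpValues hρ
    hle.trans ((hmax ρ hρ).2 hp)
  have htw := SindiciPiani.isAntisymmState_twistedState (by omega) heven
  have hval : SindiciPiani.pPPT (SindiciPiani.twistedState d) = 1 / ((d : ℝ) + 2) :=
    le_antisymm (SindiciPiani.sdpValues_twistedState_le hd heven (hmax _ htw).1) (hlow _ htw)
  have hleast : IsLeast (SindiciPiani.pPPTValues d)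
      (SindiciPiani.pPPT (SindiciPiani.twistedState d)) := by
    refine ⟨⟨_, htw, rfl⟩, ?_⟩
    rintro _ ⟨ρ, hρ, rfl⟩
    exact hval ▸ hlow ρ hρ
  have hmin : SindiciPiani.pMin d = SindiciPiani.pPPT (SindiciPiani.twistedState d) :=
    hleast.csInf_eq
  exact ⟨hmax, hmin ▸ hleast, htw, hmin, hval⟩
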